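/- For an integer $n\ge 0$ write $[x]_2\in\{0,1\}$ for $x \bmod 2$ and let $$\mathtt V_n=\{(x_1,x_2)\in\mathbb Z^2: 0\le x_1\le 2n,\ x_1\le x_2\le 2n+1\},$$ with the point $(2n,2n+1)$ removed when $n$ is odd. Let $\mathbf b=(2n,2n+1-[n]_2)\in\mathtt V_n$. Let $K_n=(K_n(x,y))_{x,y\in\mathtt V_n}$ be the skew-symmetric (Kasteleyn) matrix $K_n(x,y)=k_n(x,y)-k_n(y,x)$, where $k_n((x_1,x_2),(y_1,y_2))=1$ if one of - $[x_1+x_2]_2=0$, $x_2=y_2$ and $x_1-y_1=1$, - $[x_1+x_2]_2=0$, $x_1=y_1$ and $|y_2-x_2|=1$, - $x_1=x_2$ and $y_1=y_2=x_1-1$ holds, and $k_n((x_1,x_2),(y_1,y_2))=0$ otherwise. With $C_m=\frac1{m+1}\binom{2m}{m}$ put, for $0\le k\le n$, $$p(n,k,0)=\frac{(n+k+1)!\,(2n-k+1)!}{k!\,(3n-k+2)!}(-1)^k(3n-3k+2)\,C_{n-k},$$ and, for integers $i\ge 0$, $$h_n^{0,\mathbf b}(i)=-[i+1]_2+\sum_{k=0}^n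 p(n,k,0)\,\frac1{2\pi \mathrm i}\int_{\Gamma_0}\frac{(1+r)^{n-k}}{(1-r)\,r^{i-2k}}\,dr,$$ $$h_n^{1,\mathbf b}(i)=\sum_{k=0}^n p(n,k,0)\,\frac1{2\pi \mathrm i}\int_{\Gamma_0}\frac{(1+r)^{n-k}}{r^{i-2k+1}}\,dr,$$ where $\Gamma_0$ is any positively oriented circle around $0$ of radius less than $1$. Binomial coefficients are $\binom{a}{l}=a(a-1)\cdots(a-l+1)/l!$ for $a\in\mathbb Z$, $l\ge 0$. **Theorem 3.1.** The matrix $K_n$ is invertible, and its inverse satisfies the following. 1. If $(x_1,x_2)=(i_1,i_1+2i_2+1)$ with $0\le i_1\le 2n-1$ and $0\le i_2\le n-\lceil i_1/2\rceil$, then $(x_1,x_2)\in\mathtt V_n$ and $$K_n^{-1}((x_1,x_2),\mathbf b)=\sum_{l=0}^{i_1}(-1)^{i_2+l}\binom{i_2-1+l}{l}\,h_n^{1,\mathbf b}(i_1-l).$$ 2. If $(x_1,x_2)=(i_1,i_1+2i_2)$ with $0\le i_1\le 2n$ and $0\le i_2\le n-\lfloor i_1/2\rfloor$, then $(x_1,x_2)\in\mathtt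 V_n$ and $$K_n^{-1}((x_1,x_2),\mathbf b)=\sum_{l=0}^{i_2}(-1)^{i_2}\binom{i_2}{l}\,h_n^{0,\mathbf b}(i_1+l).$$ 3. $K_n^{-1}(\mathbf b,\mathbf b)=0$, and when $n$ is even, $K_n^{-1}((2n,2n),\mathbf b)=-1$. -/

import Mathlib

namespace TSSCPP

/-- The vertex set: `0 ≤ x₁ ≤ 2n`, `x₁ ≤ x₂ ≤ 2n+1`, without `(2n, 2n+1)` when `n` is odd. -/
def V (n : ℕ) : Finset (ℕ × ℕ) :=
  (Finset.range (2 * n + 1) ×ˢ Finset.range (2 * n + 2)).filter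
    fun x => x.1 ≤ x.2 ∧ ¬ (Odd n ∧ x = (2 * n, 2 * n + 1))

/-- The corner vertex `(2n, 2n + 1 - [n]₂)`, where `[n]₂ = n mod 2`. -/
def bVertex (n : ℕ) : V n :=
  ⟨(2 * n, 2 * n + 1 - n % 2), by
    simp only [V, Finset.mem_filter, Finset.mem_product, Finset.mem_range, Prod.mk.injEq,
      Nat.odd_iff]
    omega⟩

/-- The oriented weights `k_n`: the value is `1` exactly on the arrows `x → y`. -/
noncomputable def kWeight (x y : ℕ × ℕ) : ℂ :=
  if (Even (x.1 + x.2) ∧ x.2 = y.2 ∧ x.1 = y.1 + 1) ∨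
      (Even (x.1 + x.2) ∧ x.1 = y.1 ∧ (y.2 = x.2 + 1 ∨ x.2 = y.2 + 1)) ∨
      (x.1 = x.2 ∧ y.1 = y.2 ∧ x.1 = y.1 + 1)
  then 1 else 0

/-- The skew-symmetric Kasteleyn matrix `K_n`. -/
noncomputable def K (n : ℕ) : Matrix (V n) (V n) ℂ :=
  fun x y => kWeight x.1 y.1 - kWeight y.1 x.1

/-- The coefficient `p(n,k,ℓ)`, for `0 ≤ ℓ ≤ k ≤ n` (no subtraction truncates in this range). -/
noncomputable def p (n k l : ℕ) : ℂ :=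
  (((n + k + 1 - 2 * l).factorial : ℂ) * ((2 * n + 1 - k - l).factorial : ℂ)) /
      (((k - l).factorial : ℂ) * ((3 * n + 2 - k - 2 * l).factorial : ℂ)) *
    (-1) ^ k * (3 * (n : ℂ) - 3 * (k : ℂ) + 2) * (catalan (n - k) : ℂ)

/-- `h_n^{0,b}(i)`, the contour `Γ_0` being the positively oriented circle of radius `ρ`
around the origin. -/
noncomputable def h0 (n : ℕ) (ρ : ℝ) (i : ℕ) : ℂ :=
  -(((i + 1) % 2 : ℕ) : ℂ) +
    ∑ k ∈ Finset.range (n + 1), p n k 0 *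
      ((1 / (2 * (Real.pi : ℂ) * Complex.I)) *
        ∮ r in C(0, ρ), (1 + r) ^ (n - k) / ((1 - r) * r ^ ((i : ℤ) - 2 * (k : ℤ))))

/-- `h_n^{1,b}(i)`, the contour `Γ_0` being the positively oriented circle of radius `ρ`
around the origin. -/
noncomputable def h1 (n : ℕ) (ρ : ℝ) (i : ℕ) : ℂ :=
  ∑ k ∈ Finset.range (n + 1), p n k 0 *
    ((1 / (2 * (Real.pi : ℂ) * Complex.I)) *
      ∮ r in C(0, ρ), (1 + r) ^ (n - k) / r ^ ((i : ℤ) - 2 * (k : ℤ) + 1))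

end TSSCPP

/-!
**The column.** On an odd row, `K n *ᵥ v = 0` involves even vertices only, and on an even row off
the diagonal odd vertices only; both are three-term relations of Pascal type. So `v` is determined
on the even vertices by its values on the diagonal, and on the odd vertices by its values next to
the diagonal. Let `H(X) = ∑ k, p(n,k,0) X^{2k} (1 + X)^{n-k}` (`hSeries`). By residues
`h_n^{1,b}(i)` is the coefficient of `X^i` in `H`, and `h_n^{0,b}(i)` is that of
`X H / (1 - X) - 1 / (1 - X^2)` (`h0Series`); the formulas of the theorem are then, up to sign,
`[X^a] H (1 + X)^{-i}` at the odd vertex `(a, a + 2i + 1)` and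
`[X^{a+i}] (1 + X)^i (X H / (1 - X) - 1 / (1 - X^2))` at the even vertex `(a, a + 2i)`.
With these the Pascal relations and the diagonal relations are formal, and the top boundary
condition on the odd vertices is a vanishing binomial coefficient (`oddEntry_top`). What remains are
the top boundary condition on the even vertices and the value of `H(1)`, that is,
`[X^{2n-t}] (1 + X)^{t+1} H / (1 - X) = 2^t` for `0 ≤ t ≤ n`
(`coeff_one_add_X_pow_mul_hSeries_mul_geom`). Since `2 - X (1 + X) = (1 - X) (2 + X)`, each
case minus twice the preceding one is, up to a factor, a terminating hypergeometric sum,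
whose vanishing for `1 ≤ t ≤ n` (`sum_topTerm_eq_zero`) follows from a first-order recurrence in `t` with a
Wilf-Zeilberger certificate; a second certificate gives `H(1) = [n + 1]_2` (`sum_revCoeff`).

**Invertibility.** No matching enumeration is needed: given, for every `n`, a solution `v` of
`K n *ᵥ v = e_b`, invertibility follows by induction on `n` (`det_K_ne_zero`). Let `w` be in the
kernel. By skew symmetry `w(b) = - ⟨K w, v⟩ = 0`. If moreover `w(0, 1) = 0`, then `w` vanishes on
the odd vertices of the columns `0` and `1` and at `(1, 1)`, so its restriction to
`x₁ ≥ 2`, shifted by `(2, 2)`, lies in the kernel of `K (n - 1)`, and `w = 0` (`eq_zero_of_corner_of_first`). Hence the kernel has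
dimension at most one; as a skew-symmetric matrix of even size has even rank, it is zero
(`det_ne_zero_of_transpose_eq_neg`).
-/

/-! ### The rows of the Kasteleyn matrix -/

namespace TSSCPP
open Matrix

theorem mem_V {n a b : ℕ} :
    (a, b) ∈ V n ↔ a ≤ 2 * n ∧ b ≤ 2 * n + 1 ∧ a ≤ b ∧ ¬ (n % 2 = 1 ∧ a = 2 * n ∧ b = 2 * n + 1) := by
  simp only [V, Finset.mem_filter, Finset.mem_product, Finset.mem_range, Prod.mk.injEq,
    Nat.odd_iff]
  omega

theorem K_transpose (n : ℕ) : (K n)ᵀ = -K n := by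
  ext x y
  simp [K, Matrix.transpose_apply]

/-- A sum over the vertices of an indicator function picks out one value, also when the point
is not a vertex: this lets boundary rows be treated like interior rows. -/
theorem sum_V_single {n : ℕ} {f : ℕ × ℕ → ℂ} (hf : ∀ y, y ∉ V n → f y = 0) (z : ℕ × ℕ) :
    ∑ y : V n, (if y.1 = z then (1 : ℂ) else 0) * f y.1 = f z := by
  rw [Finset.sum_coe_sort (V n) (fun y => (if y = z then (1 : ℂ) else 0) * f y)]
  simp only [ite_mul, one_mul, zero_mul, Finset.sum_ite_eq']
  split_ifs with h
  · rfl
  · exact (hf z h).symm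

theorem ite_congr_prop {P A : Prop} [Decidable P] [Decidable A] (h : P ↔ A) :
    (if P then (1 : ℂ) else 0) = if A then 1 else 0 := by
  simp only [h]

theorem ite_or₂ {P A B : Prop} [Decidable P] [Decidable A] [Decidable B]
    (h : P ↔ A ∨ B) (hAB : ¬ (A ∧ B)) :
    (if P then (1 : ℂ) else 0) = (if A then 1 else 0) + (if B then 1 else 0) := by
  by_cases hA : A <;> by_cases hB : B <;> simp_all

theorem ite_or₃ {P A B C : Prop} [Decidable P] [Decidable A] [Decidable B] [Decidable C]
    (h : P ↔ A ∨ B ∨ C) (hAB : ¬ (A ∧ B)) (hAC : ¬ (A ∧ C)) (hBC : ¬ (B ∧ C)) :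
    (if P then (1 : ℂ) else 0) =
      (if A then 1 else 0) + (if B then 1 else 0) + (if C then 1 else 0) := by
  by_cases hA : A <;> by_cases hB : B <;> by_cases hC : C <;> simp_all

/-- An odd vertex is joined to its right, upper and lower neighbours. -/
theorem mulVec_odd {n a b : ℕ} {f : ℕ × ℕ → ℂ} (hf : ∀ y, y ∉ V n → f y = 0)
    (hx : (a, b + 1) ∈ V n) (hodd : (a + (b + 1)) % 2 = 1) :
    (K n *ᵥ fun y => f y.1) ⟨(a, b + 1), hx⟩ =
      -(f (a + 1, b + 1) + f (a, b + 2) + f (a, b)) := by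
  rw [← sum_V_single hf (a + 1, b + 1), ← sum_V_single hf (a, b + 2), ← sum_V_single hf (a, b),
    ← Finset.sum_add_distrib, ← Finset.sum_add_distrib, ← Finset.sum_neg_distrib]
  refine Finset.sum_congr rfl fun y _ => ?_
  obtain ⟨⟨c, d⟩, hy⟩ := y
  rw [← add_mul, ← add_mul, ← neg_mul]
  congr 1
  have hx' := mem_V.1 hx
  have hy' := mem_V.1 hy
  simp only [K, kWeight, Nat.even_iff, Prod.mk.injEq]
  rw [if_neg (by omega), zero_sub, neg_inj]
  exact ite_or₃ (by omega) (by omega) (by omega) (by omega)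

/-- An even vertex off the diagonal is joined to its left, upper and lower neighbours. -/
theorem mulVec_even {n a b : ℕ} {f : ℕ × ℕ → ℂ} (hf : ∀ y, y ∉ V n → f y = 0)
    (hx : (a, b + 1) ∈ V n) (heven : (a + (b + 1)) % 2 = 0) (hab : a < b + 1) :
    (K n *ᵥ fun y => f y.1) ⟨(a, b + 1), hx⟩ =
      (if a = 0 then 0 else f (a - 1, b + 1)) + f (a, b + 2) + f (a, b) := by
  obtain _ | a := a
  · rw [if_pos rfl, zero_add, ← sum_V_single hf (0, b + 2), ← sum_V_single hf (0, b),
      ← Finset.sum_add_distrib]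
    refine Finset.sum_congr rfl fun y _ => ?_
    obtain ⟨⟨c, d⟩, hy⟩ := y
    rw [← add_mul]
    congr 1
    have hx' := mem_V.1 hx
    have hy' := mem_V.1 hy
    simp only [K, kWeight, Nat.even_iff, Prod.mk.injEq]
    rw [if_neg (c := (_ ∧ d = _ ∧ _) ∨ _) (by omega), sub_zero]
    exact ite_or₂ (by omega) (by omega)
  · rw [if_neg (Nat.succ_ne_zero a), Nat.add_sub_cancel, ← sum_V_single hf (a, b + 1),
      ← sum_V_single hf (a + 1, b + 2), ← sum_V_single hf (a + 1, b),
      ← Finset.sum_add_distrib, ← Finset.sum_add_distrib]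
    refine Finset.sum_congr rfl fun y _ => ?_
    obtain ⟨⟨c, d⟩, hy⟩ := y
    rw [← add_mul, ← add_mul]
    congr 1
    have hx' := mem_V.1 hx
    have hy' := mem_V.1 hy
    simp only [K, kWeight, Nat.even_iff, Prod.mk.injEq]
    rw [if_neg (c := (_ ∧ d = _ ∧ _) ∨ _) (by omega), sub_zero]
    exact ite_or₃ (by omega) (by omega) (by omega) (by omega)

/-- A diagonal vertex is joined to its left and upper neighbours and to the adjacent diagonal
vertices. -/
theorem mulVec_diag {n a : ℕ} {f : ℕ × ℕ → ℂ} (hf : ∀ y, y ∉ V n → f y = 0)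
    (hx : (a, a) ∈ V n) :
    (K n *ᵥ fun y => f y.1) ⟨(a, a), hx⟩ =
      (if a = 0 then 0 else f (a - 1, a) + f (a - 1, a - 1)) + f (a, a + 1)
        - f (a + 1, a + 1) := by
  obtain _ | a := a
  · rw [if_pos rfl, zero_add, ← sum_V_single hf (0, 0 + 1), ← sum_V_single hf (0 + 1, 0 + 1),
      ← Finset.sum_sub_distrib]
    refine Finset.sum_congr rfl fun y _ => ?_
    obtain ⟨⟨c, d⟩, hy⟩ := y
    rw [← sub_mul]
    congr 1
    have hx' := mem_V.1 hx
    have hy' := mem_V.1 hy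
    simp only [K, kWeight, Nat.even_iff, Prod.mk.injEq, true_and]
    simp only [zero_add]
    refine congrArg₂ (fun s t : ℂ => s - t) (ite_congr_prop ?_) (ite_congr_prop ?_) <;> grind
  · rw [if_neg (Nat.succ_ne_zero a), Nat.add_sub_cancel, ← sum_V_single hf (a, a + 1),
      ← sum_V_single hf (a, a), ← sum_V_single hf (a + 1, a + 1 + 1),
      ← sum_V_single hf (a + 1 + 1, a + 1 + 1),
      ← Finset.sum_add_distrib, ← Finset.sum_add_distrib, ← Finset.sum_sub_distrib]
    refine Finset.sum_congr rfl fun y _ => ?_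
    obtain ⟨⟨c, d⟩, hy⟩ := y
    rw [← add_mul, ← add_mul, ← sub_mul]
    congr 1
    have hx' := mem_V.1 hx
    have hy' := mem_V.1 hy
    simp only [K, kWeight, Nat.even_iff, Prod.mk.injEq, true_and]
    refine congrArg₂ (fun s t : ℂ => s - t) (ite_or₃ ?_ ?_ ?_ ?_) (ite_congr_prop ?_) <;> grind

end TSSCPP

/-! ### Nonsingular skew-symmetric matrices -/

namespace TSSCPP
open Matrix

theorem det_eq_zero_of_transpose_eq_neg {ι F : Type*} [Fintype ι] [DecidableEq ι] [Field F]
    [NeZero (2 : F)] {M : Matrix ι ι F} (hM : Mᵀ = -M) (hodd : Odd (Fintype.card ι)) :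
    M.det = 0 := by
  have h : M.det = -M.det := by
    conv_lhs => rw [← det_transpose, hM, det_neg, hodd.neg_one_pow, neg_one_mul]
  have h2 : (2 : F) * M.det = 0 := by linear_combination h
  exact (mul_eq_zero.1 h2).resolve_left (NeZero.ne 2)

/-- A skew-symmetric matrix of even size is nonsingular as soon as one coordinate is injective
on its kernel, because its kernel has even dimension. -/
theorem det_ne_zero_of_transpose_eq_neg {ι F : Type*} [Fintype ι] [DecidableEq ι] [Field F]
    [NeZero (2 : F)] {M : Matrix ι ι F} (hM : Mᵀ = -M) (heven : Even (Fintype.card ι)) (a : ι)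
    (h : ∀ w, M *ᵥ w = 0 → w a = 0 → w = 0) : M.det ≠ 0 := by
  intro hdet
  obtain ⟨w, hw0, hw⟩ := exists_mulVec_eq_zero_iff.2 hdet
  have hwa : w a ≠ 0 := fun h0 => hw0 (h w hw h0)
  let N : Matrix {x : ι // x ≠ a} {x : ι // x ≠ a} F := M.submatrix Subtype.val Subtype.val
  have hN : Nᵀ = -N := by
    ext x y
    exact congrFun (congrFun hM x.1) y.1
  have hcard : Odd (Fintype.card {x : ι // x ≠ a}) := by
    have h1 : Fintype.card {x : ι // x ≠ a} = Fintype.card ι - 1 := by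
      simp [Fintype.card_subtype_compl]
    have h2 : 0 < Fintype.card ι := Fintype.card_pos_iff.2 ⟨a⟩
    rw [h1]
    exact Nat.Even.sub_odd h2 heven odd_one
  obtain ⟨z', hz0, hz'⟩ := exists_mulVec_eq_zero_iff.2 (det_eq_zero_of_transpose_eq_neg hN hcard)
  let z : ι → F := fun x => if hx : x ≠ a then z' ⟨x, hx⟩ else 0
  have hza : z a = 0 := by simp [z]
  have hzx : ∀ x : {x : ι // x ≠ a}, z x.1 = z' x := fun x => by simp [z, x.2]
  have hMz : ∀ x, x ≠ a → (M *ᵥ z) x = 0 := by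
    intro x hx
    have := congrFun hz' ⟨x, hx⟩
    simp only [mulVec, dotProduct, Pi.zero_apply] at this ⊢
    rw [Fintype.sum_eq_add_sum_subtype_ne _ a, hza, mul_zero, zero_add, ← this]
    exact Finset.sum_congr rfl fun y _ => by rw [hzx]; rfl
  -- `N` is singular because its size is odd, and `z` extends a kernel vector of `N` by zero;
  -- pairing `M *ᵥ z`, a multiple of `e_a`, with `w` shows that `z` is in the kernel of `M`.
  have hpair : w ⬝ᵥ (M *ᵥ z) = 0 := by
    rw [dotProduct_mulVec, ← mulVec_transpose, hM, neg_mulVec, hw, neg_zero, zero_dotProduct]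
  have hMza : (M *ᵥ z) a = 0 := by
    rw [dotProduct, Fintype.sum_eq_single a fun x hx => by rw [hMz x hx, mul_zero]] at hpair
    exact (mul_eq_zero.1 hpair).resolve_left hwa
  have hz : z = 0 := by
    refine h z (funext fun x => ?_) hza
    by_cases hx : x = a
    · rw [hx, hMza]; rfl
    · exact hMz x hx
  exact hz0 (funext fun x => by rw [← hzx, hz]; rfl)

/-! ### Invertibility from the corner column -/

theorem even_card_V (n : ℕ) : Even (Fintype.card (V n)) := by
  have h1 : Fintype.card (V n) = ∑ a ∈ Finset.range (2 * n + 1),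
      ((Finset.range (2 * n + 2)).filter
        fun b => a ≤ b ∧ ¬ (Odd n ∧ (a, b) = (2 * n, 2 * n + 1))).card := by
    rw [Fintype.card_coe, V, Finset.card_filter, Finset.sum_product]
    simp only [Finset.card_filter]
  have h2 : ∀ a ∈ Finset.range (2 * n), ((Finset.range (2 * n + 2)).filter
        fun b => a ≤ b ∧ ¬ (Odd n ∧ (a, b) = (2 * n, 2 * n + 1))).card = 2 * n + 2 - a := by
    intro a ha
    rw [Finset.mem_range] at ha
    rw [← Nat.card_Ico]
    congr 1
    ext b
    simp only [Finset.mem_filter, Finset.mem_range, Finset.mem_Ico, Prod.mk.injEq]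
    omega
  have h3 : ((Finset.range (2 * n + 2)).filter
      fun b => 2 * n ≤ b ∧ ¬ (Odd n ∧ (2 * n, b) = (2 * n, 2 * n + 1))).card = 2 - n % 2 := by
    have : 2 - n % 2 = (Finset.Ico (2 * n) (2 * n + 2 - n % 2)).card := by
      rw [Nat.card_Ico]; omega
    rw [this]
    congr 1
    ext b
    simp only [Finset.mem_filter, Finset.mem_range, Finset.mem_Ico, Prod.mk.injEq, Nat.odd_iff,
      true_and]
    omega
  have h4 : ∑ a ∈ Finset.range (2 * n), (2 * n + 2 - a) + ∑ a ∈ Finset.range (2 * n), a =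
      2 * n * (2 * n + 2) := by
    rw [← Finset.sum_add_distrib,
      Finset.sum_congr rfl (g := fun _ => 2 * n + 2) (fun a ha => by
        rw [Finset.mem_range] at ha; omega)]
    simp
  have h5 := Finset.sum_range_id_mul_two (2 * n)
  have h6 : 2 * n * (2 * n - 1) = 2 * (n * (2 * n - 1)) := by ring
  have h7 : 2 * n * (2 * n + 2) = 2 * (2 * (n * (n + 1))) := by ring
  have h8 : (n * (2 * n - 1)) % 2 = n % 2 := by
    rcases n with _ | m
    · rfl
    · rw [Nat.mul_mod, show (2 * (m + 1) - 1) % 2 = 1 by omega]; omega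
  rw [h1, Finset.sum_range_succ, Finset.sum_congr rfl h2, h3, Nat.even_iff]
  rw [h7] at h4
  rw [h6] at h5
  generalize ∑ a ∈ Finset.range (2 * n), (2 * n + 2 - a) = s at *
  generalize ∑ a ∈ Finset.range (2 * n), a = t at *
  generalize n * (2 * n - 1) = u at *
  generalize n * (n + 1) = q at *
  omega

/-- The extension by zero of a function on the vertex set. -/
noncomputable def extend {n : ℕ} (w : V n → ℂ) (y : ℕ × ℕ) : ℂ :=
  if h : y ∈ V n then w ⟨y, h⟩ else 0

theorem extend_of_notMem {n : ℕ} (w : V n → ℂ) (y : ℕ × ℕ) (hy : y ∉ V n) : extend w y = 0 :=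
  dif_neg hy

theorem extend_coe {n : ℕ} (w : V n → ℂ) : (fun y : V n => extend w y.1) = w :=
  funext fun y => dif_pos y.2

/-- A vector in the kernel of `K (n + 1)` that vanishes at the corner and at `(0, 1)` is zero if
`K n` has trivial kernel. -/
theorem eq_zero_of_corner_of_first {n : ℕ}
    (ih : ∀ g : V n → ℂ, K n *ᵥ g = 0 → g = 0)
    {f : ℕ × ℕ → ℂ} (hf : ∀ y, y ∉ V (n + 1) → f y = 0)
    (hker : (K (n + 1) *ᵥ fun y => f y.1) = 0)
    (hb : f (bVertex (n + 1)).1 = 0) (h01 : f (0, 1) = 0) (y : ℕ × ℕ) : f y = 0 := by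
  have hodd : ∀ a b, (a, b + 1) ∈ V (n + 1) → (a + (b + 1)) % 2 = 1 →
      f (a + 1, b + 1) + f (a, b + 2) + f (a, b) = 0 := fun a b hx hp => by
    rw [← neg_eq_zero, ← mulVec_odd hf hx hp, hker]; rfl
  have heven : ∀ a b, (a, b + 1) ∈ V (n + 1) → (a + (b + 1)) % 2 = 0 → a < b + 1 →
      (if a = 0 then 0 else f (a - 1, b + 1)) + f (a, b + 2) + f (a, b) = 0 :=
    fun a b hx hp hab => by rw [← mulVec_even hf hx hp hab, hker]; rfl
  have hdiag : ∀ a, (a, a) ∈ V (n + 1) →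
      (if a = 0 then 0 else f (a - 1, a) + f (a - 1, a - 1)) + f (a, a + 1)
        - f (a + 1, a + 1) = 0 := fun a hx => by rw [← mulVec_diag hf hx, hker]; rfl
  have c0odd : ∀ j, f (0, 2 * j + 1) = 0 := by
    intro j
    induction j with
    | zero => exact h01
    | succ j hj =>
      by_cases hm : (0, 2 * j + 1 + 1) ∈ V (n + 1)
      · have := heven 0 (2 * j + 1) hm (by omega) (by omega)
        rw [if_pos rfl, zero_add, hj, add_zero] at this
        exact this
      · apply hf
        rw [mem_V] at hm ⊢
        omega
  -- The values vanish downwards from the top, `(1, 2n + 4)` being outside the vertex set.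
  have c1even : ∀ i, f (1, 2 * (n + 2) - 2 * i) = 0 := by
    intro i
    induction i with
    | zero => apply hf; rw [mem_V]; omega
    | succ i hi =>
      by_cases hin : i ≤ n
      · have := heven 1 (2 * (n + 1 - i)) (mem_V.2 (by omega)) (by omega) (by omega)
        rw [if_neg one_ne_zero, c0odd, zero_add,
          show 2 * (n + 1 - i) + 2 = 2 * (n + 2) - 2 * i by omega, hi, zero_add,
          show 2 * (n + 1 - i) = 2 * (n + 2) - 2 * (i + 1) by omega] at this
        exact this
      · apply hf; rw [mem_V]; omega
  have c1even' : ∀ j, f (1, 2 * j) = 0 := by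
    intro j
    by_cases hj : j ≤ n + 1
    · have := c1even (n + 2 - j)
      rwa [show 2 * (n + 2) - 2 * (n + 2 - j) = 2 * j by omega] at this
    · apply hf; rw [mem_V]; omega
  have h11 : f (1, 1) = 0 := by
    have := hdiag 0 (mem_V.2 (by omega))
    rw [if_pos rfl, h01] at this
    simpa using this
  have hb' : ∀ b, 2 * (n + 1) + 1 - (n + 1) % 2 = b → f (2 * (n + 1), b) = 0 := by
    rintro _ rfl
    exact hb
  let g : ℕ × ℕ → ℂ := fun y => f (y.1 + 2, y.2 + 2)
  have hg : ∀ y, y ∉ V n → g y = 0 := by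
    rintro ⟨a, b⟩ hy
    -- The shifts of `V n` and `V (n + 1)` differ only at the point `(2n, 2n + 1)`, by parity of `n`.
    by_cases hm : (a + 2, b + 2) ∈ V (n + 1)
    · have ha : a = 2 * n := by rw [mem_V] at hy hm; omega
      subst ha
      refine hb' (b + 2) ?_
      rw [mem_V] at hy hm; omega
    · exact hf _ hm
  have hgker : (K n *ᵥ fun y => g y.1) = 0 := by
    ext ⟨⟨a, b⟩, hx⟩
    have hx' := mem_V.1 hx
    rw [Pi.zero_apply]
    rcases Nat.mod_two_eq_zero_or_one (a + b) with hp | hp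
    · rcases hx'.2.2.1.eq_or_lt with rfl | hab
      · rw [mulVec_diag hg hx]
        have := hdiag (a + 2) (mem_V.2 (by omega))
        rw [if_neg (by omega)] at this
        rcases a with _ | a
        · rw [if_pos rfl, zero_add]
          simpa [g, h11, c1even' 1] using this
        · rw [if_neg (by omega)]
          exact this
      · obtain ⟨b, rfl⟩ : ∃ c, b = c + 1 := ⟨b - 1, by omega⟩
        rw [mulVec_even hg hx hp hab]
        have := heven (a + 2) (b + 2) (mem_V.2 (by omega)) (by omega) (by omega)
        rw [if_neg (by omega)] at this
        rcases a with _ | a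
        · rw [if_pos rfl, zero_add]
          have h1 : f (1, b + 3) = 0 := by
            have := c1even' ((b + 3) / 2)
            rwa [show 2 * ((b + 3) / 2) = b + 3 by omega] at this
          simpa [g, h1] using this
        · rw [if_neg (by omega)]
          exact this
    · obtain ⟨b, rfl⟩ : ∃ c, b = c + 1 := ⟨b - 1, by omega⟩
      rw [mulVec_odd hg hx hp, neg_eq_zero]
      by_cases hm : (a + 2, b + 2 + 1) ∈ V (n + 1)
      · exact hodd (a + 2) (b + 2) hm (by omega)
      · have ha : a = 2 * n := by rw [mem_V] at hm; omega
        subst ha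
        have e1 : g (2 * n + 1, b + 1) = 0 := hf _ (by rw [mem_V]; omega)
        have e2 : g (2 * n, b + 2) = 0 := hf _ (by rw [mem_V] at hm ⊢; omega)
        have e3 : g (2 * n, b) = 0 := hb' (b + 2) (by rw [mem_V] at hm; omega)
        rw [e1, e2, e3]; norm_num
  have c2 : ∀ a b, f (a + 2, b + 2) = 0 := by
    intro a b
    have h0 := ih _ hgker
    by_cases hm : (a, b) ∈ V n
    · exact congrFun h0 ⟨(a, b), hm⟩
    · exact hg _ hm
  have c1odd : ∀ j, f (1, 2 * j + 1) = 0 := by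
    intro j
    induction j with
    | zero => exact h11
    | succ j hj =>
      by_cases hm : (1, 2 * j + 1 + 1) ∈ V (n + 1)
      · have := hodd 1 (2 * j + 1) hm (by omega)
        rw [c2 0 (2 * j), hj, zero_add, add_zero] at this
        exact this
      · apply hf
        rw [mem_V] at hm ⊢
        omega
  have c0even : ∀ j, f (0, 2 * j) = 0 := by
    intro j
    induction j with
    | zero =>
      have := hdiag 1 (mem_V.2 (by omega))
      rw [if_neg one_ne_zero] at this
      simpa [h01, c2 0 0, c1even' 1] using this
    | succ j hj =>
      by_cases hm : (0, 2 * j + 1) ∈ V (n + 1)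
      · have := hodd 0 (2 * j) hm (by omega)
        rw [zero_add, c1odd, hj, zero_add, add_zero] at this
        exact this
      · apply hf
        rw [mem_V] at hm ⊢
        omega
  obtain ⟨a, b⟩ := y
  rcases a with _ | _ | a
  · obtain ⟨j, rfl | rfl⟩ := Nat.even_or_odd' b
    exacts [c0even j, c0odd j]
  · obtain ⟨j, rfl | rfl⟩ := Nat.even_or_odd' b
    exacts [c1even' j, c1odd j]
  · by_cases hb2 : 2 ≤ b
    · obtain ⟨b, rfl⟩ := Nat.exists_eq_add_of_le' hb2
      exact c2 a b
    · apply hf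
      rw [mem_V]
      omega

/-- Solvability of `K n *ᵥ v = e_b` for all `n` implies that all `K n` are nonsingular. -/
theorem det_K_ne_zero (hv : ∀ n, ∃ v : V n → ℂ, K n *ᵥ v = Pi.single (bVertex n) 1) (n : ℕ) :
    (K n).det ≠ 0 := by
  induction n with
  | zero =>
    refine det_ne_zero_of_transpose_eq_neg (K_transpose 0) (even_card_V 0)
      ⟨(0, 1), mem_V.2 (by omega)⟩ fun w hw h01 => ?_
    have hw' : (K 0 *ᵥ fun y => extend w y.1) = 0 := by rw [extend_coe, hw]
    have h := mulVec_odd (extend_of_notMem w) (a := 0) (b := 0) (mem_V.2 (by omega)) (by omega)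
    rw [hw', extend_of_notMem w (0 + 1, 0 + 1) (by rw [mem_V]; omega),
      extend_of_notMem w (0, 0 + 2) (by rw [mem_V]; omega)] at h
    have h00 : extend w (0, 0) = 0 := by simpa using h.symm
    ext ⟨⟨a, b⟩, hx⟩
    have hx' := mem_V.1 hx
    obtain rfl : a = 0 := by omega
    obtain rfl | rfl : b = 0 ∨ b = 1 := by omega
    · rwa [extend, dif_pos hx] at h00
    · exact h01
  | succ n ih =>
    refine det_ne_zero_of_transpose_eq_neg (K_transpose _) (even_card_V _)
      ⟨(0, 1), mem_V.2 (by omega)⟩ fun w hw h01 => ?_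
    obtain ⟨v, hv⟩ := hv (n + 1)
    have hb : w (bVertex (n + 1)) = 0 := by
      have h : w ⬝ᵥ (K (n + 1) *ᵥ v) = 0 := by
        rw [dotProduct_mulVec, ← mulVec_transpose, K_transpose, neg_mulVec, hw, neg_zero,
          zero_dotProduct]
      rwa [hv, dotProduct_single, mul_one] at h
    have hw' : (K (n + 1) *ᵥ fun y => extend w y.1) = 0 := by rw [extend_coe, hw]
    have key := eq_zero_of_corner_of_first
      (fun g hg => by
        by_contra hne
        exact ih (exists_mulVec_eq_zero_iff.1 ⟨g, hne, hg⟩))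
      (extend_of_notMem w) hw'
      (by rw [extend, dif_pos (bVertex (n + 1)).2]; exact hb)
      (by rw [extend, dif_pos (mem_V.2 (by omega))]; exact h01)
    rw [← extend_coe w]
    exact funext fun y => key y.1

end TSSCPP

/-! ### Recurrences that characterize the corner column -/

namespace TSSCPP
open Matrix

/-- The function on `ℕ × ℕ` which on the even vertices `(a, a + 2i)` is `F₀ a i`, on the odd
vertices `(a, a + 2i + 1)` with `a ≠ 2n` is `F₁ a i`, and vanishes elsewhere, in particular at
the odd vertex `(2n, 2n + 1)`. -/
noncomputable def colEntry (n : ℕ) (F₀ F₁ : ℕ → ℕ → ℂ) (y : ℕ × ℕ) : ℂ :=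
  if y ∈ V n then
    if (y.1 + y.2) % 2 = 0 then F₀ y.1 ((y.2 - y.1) / 2)
    else if y.1 = 2 * n then 0 else F₁ y.1 ((y.2 - y.1) / 2)
  else 0

theorem colEntry_even {n a b i : ℕ} {F₀ F₁ : ℕ → ℕ → ℂ} (h : (a, b) ∈ V n) (hb : b = a + 2 * i) :
    colEntry n F₀ F₁ (a, b) = F₀ a i := by
  subst hb
  rw [colEntry, if_pos h, if_pos (by dsimp only; omega)]
  dsimp only
  congr 1
  omega

theorem colEntry_odd {n a b i : ℕ} {F₀ F₁ : ℕ → ℕ → ℂ} (h : (a, b) ∈ V n)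
    (hb : b = a + 2 * i + 1) (ha : a ≠ 2 * n) : colEntry n F₀ F₁ (a, b) = F₁ a i := by
  subst hb
  rw [colEntry, if_pos h, if_neg (by dsimp only; omega), if_neg ha]
  dsimp only
  congr 1
  omega

theorem colEntry_of_notMem {n : ℕ} {F₀ F₁ : ℕ → ℕ → ℂ} (y : ℕ × ℕ) (h : y ∉ V n) :
    colEntry n F₀ F₁ y = 0 := if_neg h

theorem colEntry_odd_last {n a b : ℕ} {F₀ F₁ : ℕ → ℕ → ℂ} (ha : a = 2 * n)
    (hb : b = 2 * n + 1) : colEntry n F₀ F₁ (a, b) = 0 := by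
  subst ha hb
  rw [colEntry, if_neg (c := _ % 2 = 0) (by dsimp only; omega), if_pos rfl, ite_self]

/-- The Pascal relations `r₀`, `r₁`, `r₁'`, the top boundary conditions `t₀`, `t₁`, the diagonal
relations `d`, `d'` and the corner values `c`, `c'` say that `colEntry n F₀ F₁` solves
`K n *ᵥ v = e_b`. -/
theorem mulVec_colEntry {n : ℕ} {F₀ F₁ : ℕ → ℕ → ℂ}
    (r₀ : ∀ a i, F₀ (a + 1) i + F₀ a (i + 1) + F₀ a i = 0)
    (r₁ : ∀ a i, F₁ a (i + 1) + F₁ (a + 1) (i + 1) + F₁ (a + 1) i = 0)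
    (r₁' : ∀ i, F₁ 0 (i + 1) + F₁ 0 i = 0)
    (t₀ : ∀ j, j < n → F₀ (2 * j) (n + 1 - j) = 0)
    (t₁ : ∀ j, j < n → F₁ (2 * j + 1) (n - j) = 0)
    (d : ∀ a, F₁ a 0 + F₀ a 0 + F₁ (a + 1) 0 - F₀ (a + 2) 0 = 0)
    (d' : F₁ 0 0 - F₀ 1 0 = 0)
    (c : F₀ (2 * n) 0 = if n % 2 = 0 then -1 else 0)
    (c' : ∀ m, n = m + 1 → F₁ (2 * m + 1) 0 + F₀ (2 * m + 1) 0 = if n % 2 = 0 then 0 else 1) :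
    (K n *ᵥ fun y => colEntry n F₀ F₁ y.1) = Pi.single (bVertex n) 1 := by
  have hf := @colEntry_of_notMem n F₀ F₁
  ext ⟨⟨a, b⟩, hx⟩
  have hx' := mem_V.1 hx
  have hne : (a ≠ 2 * n ∨ b ≠ 2 * n + 1 - n % 2) →
      (Pi.single (bVertex n) (1 : ℂ) : V n → ℂ) ⟨(a, b), hx⟩ = 0 := fun h => by
    apply Pi.single_eq_of_ne
    intro he
    have := congrArg Subtype.val he
    simp only [bVertex, Prod.mk.injEq] at this
    omega
  have heq : a = 2 * n → b = 2 * n + 1 - n % 2 →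
      (Pi.single (bVertex n) (1 : ℂ) : V n → ℂ) ⟨(a, b), hx⟩ = 1 := by
    rintro rfl rfl
    exact Pi.single_eq_same _ _
  rcases Nat.mod_two_eq_zero_or_one (a + b) with hp | hp
  · rcases hx'.2.2.1.eq_or_lt with rfl | hab
    · rw [mulVec_diag hf hx]
      rcases a with _ | a
      · rw [if_pos rfl, zero_add]
        rcases Nat.eq_zero_or_pos n with rfl | hn
        · rw [hne (by omega), colEntry_odd_last rfl rfl, hf (0 + 1, 0 + 1) (by rw [mem_V]; omega),
            sub_zero]
        · rw [hne (by omega), colEntry_odd (i := 0) (mem_V.2 (by omega)) rfl (by omega),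
            colEntry_even (i := 0) (mem_V.2 (by omega)) rfl, d']
      · rw [if_neg (by omega), Nat.add_sub_cancel,
          colEntry_odd (i := 0) (mem_V.2 (by omega)) rfl (by omega),
          colEntry_even (i := 0) (a := a) (b := a) (mem_V.2 (by omega)) rfl]
        by_cases han : a + 1 = 2 * n
        · obtain ⟨m, rfl⟩ : ∃ m, n = m + 1 := ⟨n - 1, by omega⟩
          obtain rfl : a = 2 * m + 1 := by omega
          rw [c' m rfl, colEntry_odd_last han (by omega), hf (_, _) (by rw [mem_V]; omega)]
          split_ifs with hm
          · rw [hne (by omega)]; norm_num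
          · rw [heq (by omega) (by omega)]; norm_num
        · rw [hne (by omega), colEntry_odd (i := 0) (mem_V.2 (by omega)) rfl (by omega),
            colEntry_even (i := 0) (mem_V.2 (by omega)) rfl, d]
    · obtain ⟨i, rfl⟩ : ∃ i, b = a + 2 * i + 1 + 1 := ⟨(b - a - 2) / 2, by omega⟩
      have htop : colEntry n F₀ F₁ (a, a + 2 * i + 1 + 2) = F₁ a (i + 1) := by
        by_cases hb : a + 2 * i + 1 + 2 ≤ 2 * n + 1
        · exact colEntry_odd (mem_V.2 (by omega)) (by omega) (by omega)
        · rw [hf _ (by rw [mem_V]; omega)]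
          obtain ⟨j, rfl⟩ : ∃ j, a = 2 * j + 1 := ⟨a / 2, by omega⟩
          rw [← t₁ j (by omega)]
          congr 1
          omega
      rw [mulVec_even hf hx hp hab, hne (by omega), htop,
        colEntry_odd (i := i) (b := a + 2 * i + 1) (mem_V.2 (by omega)) rfl (by omega)]
      rcases a with _ | a
      · rw [if_pos rfl, zero_add, r₁']
      · rw [if_neg (by omega), Nat.add_sub_cancel,
          colEntry_odd (i := i + 1) (mem_V.2 (by omega)) (by omega) (by omega), r₁]
  · obtain ⟨i, rfl⟩ : ∃ i, b = a + 2 * i + 1 := ⟨(b - a - 1) / 2, by omega⟩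
    rw [mulVec_odd hf hx hp, colEntry_even (i := i) (b := a + 2 * i) (mem_V.2 (by omega)) rfl]
    by_cases han : a = 2 * n
    · subst han
      obtain rfl : i = 0 := by omega
      rw [hf (2 * n + 1, _) (by rw [mem_V]; omega), hf (2 * n, _ + 2) (by rw [mem_V]; omega),
        c, if_pos (by omega), heq rfl (by omega)]
      norm_num
    · have htop : colEntry n F₀ F₁ (a, a + 2 * i + 2) = F₀ a (i + 1) := by
        by_cases hb : a + 2 * i + 2 ≤ 2 * n + 1
        · exact colEntry_even (mem_V.2 (by omega)) (by omega)
        · rw [hf _ (by rw [mem_V]; omega)]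
          obtain ⟨j, rfl⟩ : ∃ j, a = 2 * j := ⟨a / 2, by omega⟩
          rw [← t₀ j (by omega)]
          congr 1
          omega
      rw [hne (by omega), htop, colEntry_even (i := i) (mem_V.2 (by omega)) (by omega), r₀,
        neg_zero]

end TSSCPP

/-! ### Reciprocal factorials and the coefficients -/

namespace TSSCPP
open Finset

/-- The reciprocal factorial on `ℤ`, equal to `0` at negative integers, so that
`ifac (z - 1) = z * ifac z` holds for every `z`. -/
noncomputable def ifac (z : ℤ) : ℂ := if z < 0 then 0 else ((z.toNat.factorial : ℂ))⁻¹

theorem ifac_natCast (m : ℕ) : ifac m = ((m.factorial : ℂ))⁻¹ := by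
  rw [ifac, if_neg (by omega), Int.toNat_natCast]

theorem ifac_of_neg {z : ℤ} (hz : z < 0) : ifac z = 0 := if_pos hz

theorem ifac_sub_one (z : ℤ) : ifac (z - 1) = z * ifac z := by
  rcases lt_trichotomy z 0 with hz | rfl | hz
  · rw [ifac_of_neg hz, ifac_of_neg (by omega), mul_zero]
  · rw [ifac_of_neg (by omega), Int.cast_zero, zero_mul]
  · obtain ⟨m, rfl⟩ : ∃ m : ℕ, z = m + 1 := ⟨(z - 1).toNat, by omega⟩
    rw [add_sub_cancel_right, ifac_natCast, ← Nat.cast_succ, ifac_natCast, Nat.factorial_succ]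
    have : ((m + 1 : ℕ) : ℂ) ≠ 0 := Nat.cast_ne_zero.2 m.succ_ne_zero
    push_cast at this ⊢
    field_simp

theorem choose_eq_mul_ifac (N s : ℕ) :
    (N.choose s : ℂ) = N.factorial * ifac s * ifac ((N : ℤ) - s) := by
  rcases le_or_gt s N with h | h
  · obtain ⟨r, rfl⟩ := Nat.exists_eq_add_of_le h
    rw [show ((s + r : ℕ) : ℤ) - s = r by push_cast; ring, ifac_natCast, ifac_natCast,
      Nat.cast_add_choose]
    field_simp
  · rw [Nat.choose_eq_zero_of_lt h, ifac_of_neg (z := (N : ℤ) - s) (by omega), mul_zero,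
      Nat.cast_zero]

/-- The coefficient `(-1)^n p(n, n - m, 0)`, written with reciprocal factorials; it vanishes for
`m > n`. -/
noncomputable def revCoeff (n m : ℕ) : ℂ :=
  (-1) ^ m * ((2 * n + 1 - m).factorial * (n + m + 1).factorial * (3 * m + 2) *
    (2 * m).factorial) / ((2 * n + m + 2).factorial * m.factorial * (m + 1).factorial) *
    ifac ((n : ℤ) - m)

theorem revCoeff_of_lt {n m : ℕ} (h : n < m) : revCoeff n m = 0 := by
  rw [revCoeff, ifac_of_neg (by omega), mul_zero]

theorem catalan_eq_factorial_div (m : ℕ) :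
    (catalan m : ℂ) = (2 * m).factorial / (m.factorial * (m + 1).factorial) := by
  have h1 : ((m + 1 : ℕ) : ℂ) * catalan m = ((2 * m).choose m : ℕ) := by
    rw [← Nat.cast_mul, succ_mul_catalan_eq_centralBinom, Nat.centralBinom]
  have h2 : ((m + 1 : ℕ) : ℂ) ≠ 0 := Nat.cast_ne_zero.2 m.succ_ne_zero
  rw [two_mul, Nat.cast_add_choose, ← two_mul] at h1
  have h3 : (m.factorial : ℂ) ≠ 0 := Nat.cast_ne_zero.2 m.factorial_ne_zero
  rw [Nat.factorial_succ, Nat.cast_mul, eq_div_iff (mul_ne_zero h3 (mul_ne_zero h2 h3))]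
  rw [eq_div_iff (mul_ne_zero h3 h3)] at h1
  linear_combination h1

theorem p_sub_eq {n m : ℕ} (h : m ≤ n) : p n (n - m) 0 = (-1) ^ n * revCoeff n m := by
  obtain ⟨k, rfl⟩ := Nat.exists_eq_add_of_le h
  rw [p, revCoeff, Nat.add_sub_cancel_left, show m + k - k = m by omega,
    catalan_eq_factorial_div, show ((m + k : ℕ) : ℤ) - m = k by push_cast; ring, ifac_natCast,
    show m + k + k + 1 - 2 * 0 = 2 * (m + k) + 1 - m by omega,
    show 2 * (m + k) + 1 - k - 0 = m + k + m + 1 by omega,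
    show 3 * (m + k) + 2 - k - 2 * 0 = 2 * (m + k) + m + 2 by omega, Nat.sub_zero, pow_add]
  have hs : ((-1 : ℂ) ^ m) * (-1) ^ m = 1 := by rw [← mul_pow]; norm_num
  push_cast
  have e : (3 * ((m : ℂ) + k) - 3 * k + 2) = 3 * m + 2 := by ring
  rw [e]
  rw [mul_right_comm ((-1 : ℂ) ^ m), mul_div_assoc ((-1 : ℂ) ^ m),
    mul_assoc ((-1 : ℂ) ^ m) (_ / _), ← mul_assoc ((-1 : ℂ) ^ m) ((-1 : ℂ) ^ m), hs, one_mul]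
  field_simp

/-! ### Two hypergeometric sums -/

/-- The summand of the terminating hypergeometric sum whose vanishing for `1 ≤ t ≤ n` gives the
boundary condition along the top of the triangle. -/
noncomputable def topTerm (n t m : ℕ) : ℂ :=
  revCoeff n m * (t + m).factorial * ifac (2 * (m : ℤ) - t + 1) * ifac (2 * (t : ℤ) - m)

/-- The certificate for the recurrence in `t` of the sum of `topTerm n t`. -/
noncomputable def topCert (n t m : ℕ) : ℂ :=
  3 * (t + 1) * ((-1) ^ m * ((2 * n + 2 - m).factorial * (n + m + 1).factorial *
    (2 * m).factorial * (t + m).factorial) /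
      ((2 * n + m + 1).factorial * m.factorial * m.factorial)) *
    ifac ((n : ℤ) - m) * ifac (2 * (m : ℤ) - t - 1) * ifac (2 * (t : ℤ) - m + 2)

theorem topTerm_recurrence {n m : ℕ} (t : ℕ) (h : m ≤ n) :
    2 * (2 * t + 3) * (t - n) * (n + t + 2) * topTerm n (t + 1) m -
        t * (2 * n + 1 - t) * (2 * n + 3 + t) * topTerm n t m =
      topCert n t (m + 1) - topCert n t m := by
  obtain ⟨k, hk⟩ : ∃ k, 2 * n + 1 - m = k := ⟨_, rfl⟩
  have hkC : (k : ℂ) = 2 * n + 1 - m := by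
    have : k + m = 2 * n + 1 := by omega
    have : (k : ℂ) + m = 2 * n + 1 := by exact_mod_cast this
    linear_combination this
  have x0 : ifac (2 * (m : ℤ) - (t + 1 : ℕ) + 1) =
      (2 * m - t + 1) * ifac (2 * (m : ℤ) - t + 1) := by
    rw [show 2 * (m : ℤ) - (t + 1 : ℕ) + 1 = 2 * (m : ℤ) - t + 1 - 1 by push_cast; ring,
      ifac_sub_one]
    push_cast; ring
  have x1 : ifac (2 * (m : ℤ) - t - 1) =
      (2 * m - t) * ((2 * m - t + 1) * ifac (2 * (m : ℤ) - t + 1)) := by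
    rw [ifac_sub_one, show 2 * (m : ℤ) - t = 2 * (m : ℤ) - t + 1 - 1 by ring, ifac_sub_one]
    push_cast; ring_nf
  have x2 : ifac (2 * ((m + 1 : ℕ) : ℤ) - t - 1) = ifac (2 * (m : ℤ) - t + 1) :=
    congrArg ifac (by push_cast; ring)
  have y0 : ifac (2 * ((t + 1 : ℕ) : ℤ) - m) = ifac (2 * (t : ℤ) - m + 2) :=
    congrArg ifac (by push_cast; ring)
  have y1 : ifac (2 * (t : ℤ) - (m + 1 : ℕ) + 2) =
      (2 * t - m + 2) * ifac (2 * (t : ℤ) - m + 2) := by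
    rw [show 2 * (t : ℤ) - (m + 1 : ℕ) + 2 = 2 * (t : ℤ) - m + 2 - 1 by push_cast; ring,
      ifac_sub_one]
    push_cast; ring
  have y2 : ifac (2 * (t : ℤ) - m) =
      (2 * t - m + 1) * ((2 * t - m + 2) * ifac (2 * (t : ℤ) - m + 2)) := by
    rw [show 2 * (t : ℤ) - m = 2 * (t : ℤ) - m + 2 - 1 - 1 by ring, ifac_sub_one, ifac_sub_one]
    push_cast; ring_nf
  have z0 : ifac ((n : ℤ) - (m + 1 : ℕ)) = (n - m) * ifac ((n : ℤ) - m) := by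
    rw [show (n : ℤ) - (m + 1 : ℕ) = (n : ℤ) - m - 1 by push_cast; ring, ifac_sub_one]
    push_cast; ring
  rw [topTerm, topTerm, topCert, topCert, revCoeff, x0, x1, x2, y0, y1, y2, z0]
  generalize ifac (2 * (m : ℤ) - t + 1) = x
  generalize ifac (2 * (t : ℤ) - m + 2) = y
  generalize ifac ((n : ℤ) - m) = z
  rw [show 2 * n + 2 - (m + 1) = k by omega, show 2 * n + 2 - m = k + 1 by omega, hk,
    show n + (m + 1) + 1 = n + m + 1 + 1 by ring, show 2 * (m + 1) = 2 * m + 1 + 1 by ring,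
    show t + (m + 1) = t + m + 1 by ring, show t + 1 + m = t + m + 1 by ring,
    show 2 * n + (m + 1) + 1 = 2 * n + m + 1 + 1 by ring,
    show 2 * n + m + 2 = 2 * n + m + 1 + 1 by ring]
  simp only [Nat.factorial_succ, Nat.cast_mul, pow_succ]
  have f1 : (m.factorial : ℂ) ≠ 0 := Nat.cast_ne_zero.2 m.factorial_ne_zero
  have f2 : ((2 * n + m).factorial : ℂ) ≠ 0 := Nat.cast_ne_zero.2 (2 * n + m).factorial_ne_zero
  have f3 : ((m + 1 : ℕ) : ℂ) ≠ 0 := Nat.cast_ne_zero.2 (by omega)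
  have f4 : ((2 * n + m + 1 : ℕ) : ℂ) ≠ 0 := Nat.cast_ne_zero.2 (by omega)
  have f5 : ((2 * n + m + 1 + 1 : ℕ) : ℂ) ≠ 0 := Nat.cast_ne_zero.2 (by omega)
  push_cast at f3 f4 f5 ⊢
  rw [hkC]
  generalize (m.factorial : ℂ) = A at *
  generalize ((2 * n + m).factorial : ℂ) = B at *
  field_simp
  ring

/-- In the recurrence in `t`, the coefficient of the sum at `t` vanishes for `t = 0`, so the sum at
`1` is zero; the coefficient of the sum at `t + 1` is nonzero until `t = n`. -/
theorem sum_topTerm_eq_zero {n t : ℕ} (h1 : 1 ≤ t) (hn : t ≤ n) :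
    ∑ m ∈ range (n + 1), topTerm n t m = 0 := by
  have key : ∀ t : ℕ, 2 * (2 * t + 3) * (t - n) * (n + t + 2) *
        ∑ m ∈ range (n + 1), topTerm n (t + 1) m =
      t * (2 * n + 1 - t) * (2 * n + 3 + t) * ∑ m ∈ range (n + 1), topTerm n t m := by
    intro t
    rw [← sub_eq_zero, mul_sum, mul_sum, ← sum_sub_distrib,
      sum_congr rfl fun m hm => topTerm_recurrence t (by rw [mem_range] at hm; omega),
      sum_range_sub, topCert, topCert, ifac_of_neg (z := (n : ℤ) - (n + 1 : ℕ)) (by omega),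
      ifac_of_neg (z := 2 * ((0 : ℕ) : ℤ) - t - 1) (by omega)]
    ring
  induction t, h1 using Nat.le_induction with
  | base =>
    have h := key 0
    rw [Nat.cast_zero, zero_mul, zero_mul, zero_mul] at h
    refine (mul_eq_zero.1 h).resolve_left ?_
    have h0 : (n : ℂ) ≠ 0 := Nat.cast_ne_zero.2 (by omega)
    have h2 : ((n + 2 : ℕ) : ℂ) ≠ 0 := Nat.cast_ne_zero.2 (by omega)
    push_cast at h2
    simp [h0, h2]
  | succ t _ ih =>
    have h := key t
    rw [ih (by omega), mul_zero] at h
    refine (mul_eq_zero.1 h).resolve_left ?_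
    have h0 : (t : ℂ) - n ≠ 0 := sub_ne_zero.2 (by exact_mod_cast (by omega : t ≠ n))
    have h2 : ((n + t + 2 : ℕ) : ℂ) ≠ 0 := Nat.cast_ne_zero.2 (by omega)
    have h3 : ((2 * t + 3 : ℕ) : ℂ) ≠ 0 := Nat.cast_ne_zero.2 (by omega)
    push_cast at h2 h3
    exact mul_ne_zero (mul_ne_zero (mul_ne_zero two_ne_zero h3) h0) h2

/-- The certificate for the recurrence in `n` of the sum of `2 ^ m * revCoeff n m`. -/
noncomputable def normCert (n m : ℕ) : ℂ :=
  -(2 * n + 3) * ((-2) ^ m * ((2 * n + 2 - m).factorial * (n + m + 1).factorial *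
    (2 * m).factorial) / ((2 * n + m + 3).factorial * m.factorial * m.factorial)) *
    ifac ((n : ℤ) + 1 - m)

/-- Summed over `m`, this says that the sums of `2 ^ m * revCoeff n m` for `n` and `n + 1` add up
to `- normCert n 0 = 1`. -/
theorem revCoeff_recurrence {n m : ℕ} (h : m ≤ n + 1) :
    2 ^ m * revCoeff (n + 1) m + 2 ^ m * revCoeff n m = normCert n (m + 1) - normCert n m := by
  obtain ⟨k, hk⟩ : ∃ k, 2 * n + 1 - m = k := ⟨_, rfl⟩
  have hkC : (k : ℂ) = 2 * n + 1 - m := by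
    have : k + m = 2 * n + 1 := by omega
    have : (k : ℂ) + m = 2 * n + 1 := by exact_mod_cast this
    linear_combination this
  have z0 : ifac ((n : ℤ) - m) = (n + 1 - m) * ifac ((n : ℤ) + 1 - m) := by
    rw [show (n : ℤ) - m = (n : ℤ) + 1 - m - 1 by ring, ifac_sub_one]
    push_cast; ring
  have z1 : ifac ((n : ℤ) + 1 - (m + 1 : ℕ)) = (n + 1 - m) * ifac ((n : ℤ) + 1 - m) := by
    rw [← z0]; congr 1; push_cast; ring
  have z2 : ifac (((n + 1 : ℕ) : ℤ) - m) = ifac ((n : ℤ) + 1 - m) := by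
    congr 1
  rw [revCoeff, revCoeff, normCert, normCert, z0, z1, z2]
  generalize ifac ((n : ℤ) + 1 - m) = z
  rw [show 2 * n + 2 - (m + 1) = k by omega, show 2 * n + 2 - m = k + 1 by omega, hk,
    show 2 * (n + 1) + 1 - m = k + 1 + 1 by omega,
    show n + (m + 1) + 1 = n + m + 1 + 1 by ring, show 2 * (m + 1) = 2 * m + 1 + 1 by ring,
    show n + 1 + m + 1 = n + m + 1 + 1 by ring,
    show 2 * (n + 1) + m + 2 = 2 * n + m + 2 + 1 + 1 by ring,
    show 2 * n + (m + 1) + 3 = 2 * n + m + 2 + 1 + 1 by ring,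
    show 2 * n + m + 3 = 2 * n + m + 2 + 1 by ring, show (-2 : ℂ) = -1 * 2 by ring]
  simp only [Nat.factorial_succ, Nat.cast_mul, pow_succ, mul_pow]
  have f1 : (m.factorial : ℂ) ≠ 0 := Nat.cast_ne_zero.2 m.factorial_ne_zero
  have f2 : ((2 * n + m).factorial : ℂ) ≠ 0 :=
    Nat.cast_ne_zero.2 (2 * n + m).factorial_ne_zero
  have f3 : ((m + 1 : ℕ) : ℂ) ≠ 0 := Nat.cast_ne_zero.2 (by omega)
  have f4 : ((2 * n + m + 3 : ℕ) : ℂ) ≠ 0 := Nat.cast_ne_zero.2 (by omega)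
  have f5 : ((2 * n + m + 4 : ℕ) : ℂ) ≠ 0 := Nat.cast_ne_zero.2 (by omega)
  have f6 : ((2 * n + m + 1 : ℕ) : ℂ) ≠ 0 := Nat.cast_ne_zero.2 (by omega)
  have f7 : ((2 * n + m + 2 : ℕ) : ℂ) ≠ 0 := Nat.cast_ne_zero.2 (by omega)
  push_cast at f3 f4 f5 f6 f7 ⊢
  have e3 : (2 * (n : ℂ) + m + 2 + 1) = 2 * n + m + 3 := by ring
  have e4 : (2 * (n : ℂ) + m + 3 + 1) = 2 * n + m + 4 := by ring
  have e2 : (2 * (n : ℂ) + m + 1 + 1) = 2 * n + m + 2 := by ring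
  rw [hkC, e2, e3, e4]
  generalize (m.factorial : ℂ) = A at *
  generalize ((2 * n + m).factorial : ℂ) = B at *
  generalize (2 : ℂ) ^ m = D
  field_simp
  ring

/-- The value of `(-1)^n H(1)`. -/
theorem sum_revCoeff (n : ℕ) :
    ∑ m ∈ range (n + 1), 2 ^ m * revCoeff n m = if n % 2 = 0 then 1 else 0 := by
  induction n with
  | zero => simp [revCoeff, ifac]
  | succ n ih =>
    have h : ∑ m ∈ range (n + 2), 2 ^ m * revCoeff (n + 1) m +
        ∑ m ∈ range (n + 2), 2 ^ m * revCoeff n m = 1 := by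
      rw [← sum_add_distrib,
        sum_congr rfl fun m hm => revCoeff_recurrence (by rw [mem_range] at hm; omega),
        sum_range_sub, normCert, normCert,
        ifac_of_neg (z := (n : ℤ) + 1 - (n + 2 : ℕ)) (by omega),
        show (n : ℤ) + 1 - (0 : ℕ) = (n + 1 : ℕ) by push_cast; ring, ifac_natCast]
      have f1 : ((n + 1).factorial : ℂ) ≠ 0 := Nat.cast_ne_zero.2 (n + 1).factorial_ne_zero
      have f2 : ((2 * n + 2).factorial : ℂ) ≠ 0 := Nat.cast_ne_zero.2 (Nat.factorial_ne_zero _)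
      have f3 : ((2 * n + 3 : ℕ) : ℂ) ≠ 0 := Nat.cast_ne_zero.2 (by omega)
      simp only [Nat.sub_zero, add_zero, Nat.factorial_succ (2 * n + 2), Nat.cast_mul, mul_zero,
        Nat.factorial_zero]
      push_cast at f3 ⊢
      rw [show (2 * (n : ℂ) + 2 + 1) = 2 * n + 3 by ring]
      field_simp
      norm_num
    rw [sum_range_succ (fun m => 2 ^ m * revCoeff n m), revCoeff_of_lt (by omega), mul_zero,
      add_zero, ih] at h
    rw [← sub_eq_iff_eq_add.2 h.symm]
    split_ifs <;> first | omega | norm_num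

end TSSCPP

/-! ### The generating polynomial of the corner column -/

namespace TSSCPP
open Finset PowerSeries

/-- The geometric series `1 / (1 - X)`. -/
noncomputable def geom : ℂ⟦X⟧ := mk 1

theorem geom_mul_one_sub : geom * (1 - X) = 1 := mk_one_mul_one_sub_eq_one ℂ

theorem coeff_one_add_X_mul (f : ℂ⟦X⟧) (d : ℕ) :
    coeff (d + 1) ((1 + X) * f) = coeff (d + 1) f + coeff d f := by
  rw [add_mul, one_mul, map_add, coeff_succ_X_mul]

theorem coeff_one_add_X_pow (N s : ℕ) : coeff s ((1 + X : ℂ⟦X⟧) ^ N) = N.choose s := by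
  have h : (1 + X : ℂ⟦X⟧) ^ N =
      (((1 + Polynomial.X : Polynomial ℂ) ^ N : Polynomial ℂ) : ℂ⟦X⟧) := by simp
  rw [h, Polynomial.coeff_coe, Polynomial.coeff_one_add_X_pow]

theorem coeff_one_add_X_pow_mul_geom {N d : ℕ} (h : N ≤ d) :
    coeff d ((1 + X) ^ N * geom) = 2 ^ N := by
  induction N generalizing d with
  | zero => simp [geom]
  | succ N ih =>
    obtain ⟨d, rfl⟩ : ∃ e, d = e + 1 := ⟨d - 1, by omega⟩
    rw [pow_succ', mul_assoc, coeff_one_add_X_mul, ih (by omega), ih (by omega), pow_succ]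
    ring

/-- The polynomial `∑ k, p(n,k,0) r^{2k} (1 + r)^{n-k}`, whose coefficients are the numbers
`h_n^{1,b}(i)`. -/
noncomputable def hSeries (n : ℕ) : ℂ⟦X⟧ :=
  ∑ k ∈ range (n + 1), C (p n k 0) * (X ^ (2 * k) * (1 + X) ^ (n - k))

theorem coeff_hSeries_mul (n d : ℕ) (f : ℂ⟦X⟧) :
    coeff d (hSeries n * f) = ∑ k ∈ range (n + 1), p n k 0 *
      (if 2 * k ≤ d then coeff (d - 2 * k) ((1 + X) ^ (n - k) * f) else 0) := by
  rw [hSeries, sum_mul, map_sum]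
  refine sum_congr rfl fun k _ => ?_
  rw [mul_assoc, coeff_C_mul, mul_assoc, coeff_X_pow_mul']

theorem coeff_hSeries (n d : ℕ) :
    coeff d (hSeries n) = ∑ k ∈ range (n + 1), p n k 0 *
      (if 2 * k ≤ d then ((n - k).choose (d - 2 * k) : ℂ) else 0) := by
  have h := coeff_hSeries_mul n d 1
  simpa only [mul_one, coeff_one_add_X_pow] using h

theorem p_self (n : ℕ) : p n n 0 = (-1) ^ n := by
  have h := p_sub_eq (Nat.zero_le n)
  rw [Nat.sub_zero] at h
  rw [h, revCoeff, show (n : ℤ) - (0 : ℕ) = n from sub_zero _, ifac_natCast]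
  have f1 : (n.factorial : ℂ) ≠ 0 := Nat.cast_ne_zero.2 n.factorial_ne_zero
  have f2 : ((2 * n + 1).factorial : ℂ) ≠ 0 := Nat.cast_ne_zero.2 (Nat.factorial_ne_zero _)
  have f3 : ((n + 1 : ℕ) : ℂ) ≠ 0 := Nat.cast_ne_zero.2 (by omega)
  simp only [Nat.sub_zero, add_zero, Nat.factorial_succ (2 * n + 1), Nat.factorial_succ n,
    Nat.cast_mul, mul_zero, zero_add, Nat.factorial_zero, Nat.factorial_one, pow_zero,
    Nat.cast_zero]
  push_cast at f3 ⊢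
  have f4 : (2 * (n : ℂ) + 1 + 1) = 2 * (n + 1) := by ring
  rw [f4]
  field_simp

/-- Reversal of the summation, `k = n - m`. -/
theorem sum_p_eq (n : ℕ) (a : ℕ → ℂ) :
    ∑ k ∈ range (n + 1), p n k 0 * a k =
      (-1) ^ n * ∑ m ∈ range (n + 1), revCoeff n m * a (n - m) := by
  rw [← sum_range_reflect, mul_sum]
  refine sum_congr rfl fun m hm => ?_
  rw [mem_range] at hm
  rw [show n + 1 - 1 - m = n - m by omega, p_sub_eq (by omega), mul_assoc]

/-- The value `H(1)`. -/
theorem sum_p_two_pow (n : ℕ) :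
    ∑ k ∈ range (n + 1), p n k 0 * 2 ^ (n - k) = if n % 2 = 0 then 1 else 0 := by
  rw [sum_p_eq, sum_congr rfl (g := fun m => 2 ^ m * revCoeff n m) fun m hm => by
    rw [mem_range] at hm
    rw [show n - (n - m) = m by omega, mul_comm], sum_revCoeff]
  split_ifs with h
  · rw [(Nat.even_iff.2 h).neg_one_pow, one_mul]
  · rw [mul_zero]

theorem coeff_hSeries_last (n : ℕ) : coeff (2 * n) (hSeries n) = (-1) ^ n := by
  rw [coeff_hSeries, sum_range_succ, sum_eq_zero fun k hk => ?_]
  · simp [p_self]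
  · rw [mem_range] at hk
    rw [Nat.choose_eq_zero_of_lt (by omega), Nat.cast_zero, ite_self, mul_zero]

/-- Since `H` has degree at most `2n`, this coefficient is `H(1)`. -/
theorem coeff_hSeries_mul_geom (n : ℕ) :
    coeff (2 * n) (hSeries n * geom) = if n % 2 = 0 then 1 else 0 := by
  rw [coeff_hSeries_mul, ← sum_p_two_pow]
  refine sum_congr rfl fun k hk => ?_
  rw [mem_range] at hk
  rw [if_pos (by omega), coeff_one_add_X_pow_mul_geom (by omega)]

theorem coeff_one_add_X_mul_hSeries_mul_geom (n : ℕ) :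
    coeff (2 * n) ((1 + X) * (hSeries n * geom)) = 1 := by
  have h : (1 + X) * (hSeries n * geom) = 2 * (hSeries n * geom) - hSeries n := by
    linear_combination (-hSeries n) * geom_mul_one_sub
  rw [h, map_sub, ← map_ofNat (C (R := ℂ)) 2, coeff_C_mul, coeff_hSeries_mul_geom,
    coeff_hSeries_last]
  split_ifs with h2
  · rw [(Nat.even_iff.2 h2).neg_one_pow]; norm_num
  · rw [(Nat.odd_iff.2 (by omega)).neg_one_pow]; norm_num

/-- The two binomial coefficients combine into one product, because
`2 (2t - m) + (2m - t + 1) = 3t + 1`. -/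
theorem coeff_one_add_X_pow_mul_two_add_X {t m : ℕ} (h : t ≤ 2 * m + 1) :
    coeff (2 * m + 1 - t) ((1 + X : ℂ⟦X⟧) ^ (t + m) * (2 + X)) =
      (3 * t + 1) * ((t + m).factorial * ifac (2 * (m : ℤ) - t + 1) * ifac (2 * (t : ℤ) - m)) := by
  have e1 : ifac (((t + m : ℕ) : ℤ) - (2 * m + 1 - t : ℕ)) =
      (2 * t - m) * ifac (2 * (t : ℤ) - m) := by
    rw [show ((t + m : ℕ) : ℤ) - (2 * m + 1 - t : ℕ) = 2 * (t : ℤ) - m - 1 by omega,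
      ifac_sub_one]
    push_cast; ring
  have e2 : ((2 * m + 1 - t : ℕ) : ℤ) = 2 * (m : ℤ) - t + 1 := by omega
  rw [mul_add, mul_comm _ (2 : ℂ⟦X⟧), ← map_ofNat (C (R := ℂ)) 2, map_add, coeff_C_mul,
    coeff_one_add_X_pow, choose_eq_mul_ifac, e1, e2]
  rcases h.eq_or_lt with rfl | h'
  · have e3 : ifac (2 * (m : ℤ) - (2 * m + 1 : ℕ) + 1) = 1 := by
      rw [show 2 * (m : ℤ) - (2 * m + 1 : ℕ) + 1 = (0 : ℕ) by push_cast; ring, ifac_natCast]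
      simp
    rw [e3, Nat.sub_self, coeff_zero_mul_X]
    push_cast
    ring
  · obtain ⟨s, hs⟩ : ∃ s, 2 * m + 1 - t = s + 1 := ⟨2 * m - t, by omega⟩
    have e4 : ifac s = (2 * m - t + 1) * ifac (2 * (m : ℤ) - t + 1) := by
      rw [show (s : ℤ) = 2 * (m : ℤ) - t + 1 - 1 by omega, ifac_sub_one]
      push_cast; ring
    rw [hs, coeff_succ_mul_X, coeff_one_add_X_pow, choose_eq_mul_ifac, e4,
      show ((t + m : ℕ) : ℤ) - s = 2 * (t : ℤ) - m by omega]
    ring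

theorem coeff_hSeries_mul_two_add_X {n t : ℕ} (h1 : 1 ≤ t) (hn : t ≤ n) :
    coeff (2 * n + 1 - t) ((1 + X) ^ t * ((2 + X) * hSeries n)) = 0 := by
  rw [show (1 + X) ^ t * ((2 + X) * hSeries n) = hSeries n * ((1 + X) ^ t * (2 + X)) by ring,
    coeff_hSeries_mul, sum_p_eq]
  have h := sum_topTerm_eq_zero h1 hn
  rw [sum_congr rfl (g := fun m => (3 * t + 1) * topTerm n t m) fun m hm => ?_, ← mul_sum, h,
    mul_zero, mul_zero]
  rw [mem_range] at hm
  rw [← mul_assoc, ← pow_add, show n - (n - m) + t = t + m by omega, topTerm]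
  split_ifs with hle
  · rw [show 2 * n + 1 - t - 2 * (n - m) = 2 * m + 1 - t by omega,
      coeff_one_add_X_pow_mul_two_add_X (by omega)]
    ring
  · rw [ifac_of_neg (z := 2 * (m : ℤ) - t + 1) (by omega)]
    ring

theorem coeff_one_add_X_pow_mul_hSeries_mul_geom {n t : ℕ} (hn : t ≤ n) :
    coeff (2 * n - t) ((1 + X) ^ (t + 1) * (hSeries n * geom)) = 2 ^ t := by
  induction t with
  | zero => rw [zero_add, pow_one, pow_zero]; exact coeff_one_add_X_mul_hSeries_mul_geom n
  | succ t ih =>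
    have h : X * ((1 + X) ^ (t + 1 + 1) * (hSeries n * geom)) =
        2 * ((1 + X) ^ (t + 1) * (hSeries n * geom)) -
          (1 + X) ^ (t + 1) * ((2 + X) * hSeries n) := by
      linear_combination (-(1 + X) ^ (t + 1) * (2 + X) * hSeries n) * geom_mul_one_sub
    have h2 := congrArg (coeff (2 * n - t)) h
    have h3 := coeff_hSeries_mul_two_add_X (t := t + 1) (by omega) hn
    rw [show 2 * n + 1 - (t + 1) = 2 * n - t by omega] at h3
    rw [map_sub, ← map_ofNat (C (R := ℂ)) 2, coeff_C_mul, ih (by omega), map_ofNat, h3, sub_zero,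
      show 2 * n - t = 2 * n - (t + 1) + 1 by omega, coeff_succ_X_mul] at h2
    rw [h2, pow_succ']

end TSSCPP

/-! ### The contour integrals -/

namespace TSSCPP
open Finset PowerSeries

theorem contour_zpow {ρ : ℝ} (hρ : 0 < ρ) (z : ℤ) :
    (∮ r in C(0, ρ), r ^ z) = if z = -1 then 2 * (Real.pi : ℂ) * Complex.I else 0 := by
  split_ifs with h
  · have := circleIntegral.integral_sub_center_inv 0 hρ.ne'
    simpa [h] using this
  · have := circleIntegral.integral_sub_zpow_of_ne h 0 0 ρ
    simpa using this

theorem ne_zero_of_mem_sphere {ρ : ℝ} (hρ : 0 < ρ) {r : ℂ} (hr : r ∈ Metric.sphere (0 : ℂ) ρ) :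
    r ≠ 0 := by
  rintro rfl
  simp at hr
  exact hρ.ne hr

theorem one_sub_ne_zero_of_mem_closedBall {ρ : ℝ} (hρ : ρ < 1) {r : ℂ}
    (hr : r ∈ Metric.closedBall (0 : ℂ) ρ) : 1 - r ≠ 0 := by
  intro h
  rw [← sub_eq_zero.1 h] at hr
  simp at hr
  linarith

theorem contour_one_add_pow_div {ρ : ℝ} (hρ : 0 < ρ) (N k i : ℕ) :
    (∮ r in C(0, ρ), (1 + r) ^ N / r ^ ((i : ℤ) - 2 * (k : ℤ) + 1)) =
      (2 * (Real.pi : ℂ) * Complex.I) *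
        (if 2 * k ≤ i then (N.choose (i - 2 * k) : ℂ) else 0) := by
  have h1 : Set.EqOn (fun r : ℂ => (1 + r) ^ N / r ^ ((i : ℤ) - 2 * (k : ℤ) + 1))
      (fun r => ∑ s ∈ range (N + 1),
        (N.choose s : ℂ) * r ^ ((s : ℤ) - ((i : ℤ) - 2 * (k : ℤ) + 1)))
      (Metric.sphere 0 ρ) := by
    intro r hr
    have hr0 := ne_zero_of_mem_sphere hρ hr
    dsimp only
    rw [add_comm 1 r, add_pow, sum_div]
    refine sum_congr rfl fun s _ => ?_
    rw [zpow_sub₀ hr0, zpow_natCast, one_pow]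
    ring
  have hint : ∀ s ∈ range (N + 1), CircleIntegrable
      (fun r : ℂ => (N.choose s : ℂ) * r ^ ((s : ℤ) - ((i : ℤ) - 2 * (k : ℤ) + 1))) 0 ρ := by
    intro s _
    refine ContinuousOn.circleIntegrable hρ.le (continuousOn_const.mul ?_)
    exact fun r hr => (continuousAt_zpow₀ r _
      (Or.inl (ne_zero_of_mem_sphere hρ hr))).continuousWithinAt
  rw [circleIntegral.integral_congr hρ.le h1, circleIntegral.integral_fun_sum hint]
  simp only [circleIntegral.integral_const_mul, contour_zpow hρ]
  split_ifs with h
  · rw [sum_eq_single (i - 2 * k), if_pos (by omega), mul_comm]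
    · intro s _ hs
      rw [if_neg (by omega), mul_zero]
    · intro hs
      rw [mem_range] at hs
      rw [Nat.choose_eq_zero_of_lt (by omega), Nat.cast_zero, zero_mul]
  · rw [mul_zero]
    refine sum_eq_zero fun s _ => ?_
    rw [if_neg (by omega), mul_zero]

/-- The partial sums arise by induction on `i` from
`1 / ((1 - r) r^{j+1}) = 1 / ((1 - r) r^j) + 1 / r^{j+1}`, starting with a holomorphic
integrand at `i = 0`. -/
theorem contour_one_add_pow_div_one_sub {ρ : ℝ} (hρ : 0 < ρ) (hρ1 : ρ < 1) (N k i : ℕ) :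
    (∮ r in C(0, ρ), (1 + r) ^ N / ((1 - r) * r ^ ((i : ℤ) - 2 * (k : ℤ)))) =
      (2 * (Real.pi : ℂ) * Complex.I) *
        ∑ j ∈ range i, (if 2 * k ≤ j then (N.choose (j - 2 * k) : ℂ) else 0) := by
  induction i with
  | zero =>
    have h1 : Set.EqOn (fun r : ℂ => (1 + r) ^ N / ((1 - r) * r ^ (((0 : ℕ) : ℤ) - 2 * (k : ℤ))))
        (fun r => (1 + r) ^ N * r ^ (2 * k) / (1 - r)) (Metric.sphere 0 ρ) := by
      intro r hr
      have hr0 := ne_zero_of_mem_sphere hρ hr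
      have e : r ^ (((0 : ℕ) : ℤ) - 2 * (k : ℤ)) = (r ^ (2 * k))⁻¹ := by
        rw [Nat.cast_zero, zero_sub, zpow_neg]
        norm_cast
      dsimp only
      rw [e]
      field_simp
    rw [circleIntegral.integral_congr hρ.le h1, sum_range_zero, mul_zero]
    have hd : ∀ r ∈ Metric.closedBall (0 : ℂ) ρ,
        DifferentiableAt ℂ (fun r : ℂ => (1 + r) ^ N * r ^ (2 * k) / (1 - r)) r := fun r hr =>
      DifferentiableAt.div (by fun_prop) (by fun_prop) (one_sub_ne_zero_of_mem_closedBall hρ1 hr)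
    exact Complex.circleIntegral_eq_zero_of_differentiable_on_off_countable hρ.le
      Set.countable_empty (fun r hr => (hd r hr).continuousAt.continuousWithinAt)
      fun r hr => hd r (Metric.ball_subset_closedBall hr.1)
  | succ i ih =>
    have h1 : Set.EqOn
        (fun r : ℂ => (1 + r) ^ N / ((1 - r) * r ^ (((i + 1 : ℕ) : ℤ) - 2 * (k : ℤ))))
        (fun r => (1 + r) ^ N / ((1 - r) * r ^ ((i : ℤ) - 2 * (k : ℤ))) +
          (1 + r) ^ N / r ^ ((i : ℤ) - 2 * (k : ℤ) + 1)) (Metric.sphere 0 ρ) := by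
      intro r hr
      have hr0 := ne_zero_of_mem_sphere hρ hr
      have hr1 := one_sub_ne_zero_of_mem_closedBall hρ1 (Metric.sphere_subset_closedBall hr)
      dsimp only
      rw [show ((i + 1 : ℕ) : ℤ) - 2 * (k : ℤ) = (i : ℤ) - 2 * (k : ℤ) + 1 by push_cast; ring,
        zpow_add_one₀ hr0]
      have := zpow_ne_zero ((i : ℤ) - 2 * (k : ℤ)) hr0
      generalize r ^ ((i : ℤ) - 2 * (k : ℤ)) = q at *
      field_simp
      ring
    have hz : ∀ z : ℤ, ContinuousOn (fun r : ℂ => r ^ z) (Metric.sphere 0 ρ) := fun z r hr =>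
      (continuousAt_zpow₀ r _ (Or.inl (ne_zero_of_mem_sphere hρ hr))).continuousWithinAt
    have hp : ContinuousOn (fun r : ℂ => (1 + r) ^ N) (Metric.sphere 0 ρ) := by fun_prop
    rw [circleIntegral.integral_congr hρ.le h1, circleIntegral.integral_add, ih,
      contour_one_add_pow_div hρ, sum_range_succ, mul_add]
    · refine ContinuousOn.circleIntegrable hρ.le (hp.div ((by fun_prop : ContinuousOn
        (fun r : ℂ => 1 - r) (Metric.sphere 0 ρ)).mul (hz _)) fun r hr => mul_ne_zero
          (one_sub_ne_zero_of_mem_closedBall hρ1 (Metric.sphere_subset_closedBall hr))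
          (zpow_ne_zero _ (ne_zero_of_mem_sphere hρ hr)))
    · exact ContinuousOn.circleIntegrable hρ.le (hp.div (hz _) fun r hr =>
        zpow_ne_zero _ (ne_zero_of_mem_sphere hρ hr))

theorem one_div_two_pi_I_mul (z : ℂ) :
    1 / (2 * (Real.pi : ℂ) * Complex.I) * (2 * (Real.pi : ℂ) * Complex.I * z) = z := by
  rw [← mul_assoc, one_div_mul_cancel Complex.two_pi_I_ne_zero, one_mul]

theorem h1_eq_coeff (n : ℕ) {ρ : ℝ} (hρ : 0 < ρ) (i : ℕ) : h1 n ρ i = coeff i (hSeries n) := by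
  rw [h1, coeff_hSeries]
  refine sum_congr rfl fun k _ => ?_
  rw [contour_one_add_pow_div hρ, one_div_two_pi_I_mul]

/-! ### The entries of the corner column -/

/-- The generating function `∑ h_n^{0,b}(i) X^i`, equal to
`X H / (1 - X) - 1 / (1 - X^2)` with `H` the series `hSeries n`. -/
noncomputable def h0Series (n : ℕ) : ℂ⟦X⟧ :=
  X * (hSeries n * geom) - PowerSeries.mk fun i => (((i + 1) % 2 : ℕ) : ℂ)

theorem coeff_X_mul_mul_geom (f : ℂ⟦X⟧) (i : ℕ) :
    coeff i (X * (f * geom)) = ∑ j ∈ range i, coeff j f := by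
  induction i with
  | zero => simp
  | succ i ih =>
    have h : X * (f * geom) = X * (X * (f * geom)) + X * f := by
      linear_combination X * f * geom_mul_one_sub
    rw [h, map_add, coeff_succ_X_mul, coeff_succ_X_mul, ih, sum_range_succ]

theorem h0_eq_coeff (n : ℕ) {ρ : ℝ} (hρ : 0 < ρ) (hρ1 : ρ < 1) (i : ℕ) :
    h0 n ρ i = coeff i (h0Series n) := by
  rw [h0, h0Series, map_sub, coeff_mk, coeff_X_mul_mul_geom]
  simp only [coeff_hSeries, contour_one_add_pow_div_one_sub hρ hρ1, one_div_two_pi_I_mul, mul_sum]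
  rw [sum_comm]
  ring

/-- The entry of the inverse column at the even vertex `(a, a + 2i)`. -/
noncomputable def evenEntry (n a i : ℕ) : ℂ :=
  (-1) ^ i * coeff (a + i) ((1 + X) ^ i * h0Series n)

/-- The entry of the inverse column at the odd vertex `(a, a + 2i + 1)`. -/
noncomputable def oddEntry (n a i : ℕ) : ℂ :=
  (-1) ^ i * coeff a (hSeries n * binomialSeries ℂ (-(i : ℤ)))

theorem evenEntry_zero (n a : ℕ) : evenEntry n a 0 = coeff a (h0Series n) := by
  simp [evenEntry]

theorem oddEntry_zero (n a : ℕ) : oddEntry n a 0 = coeff a (hSeries n) := by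
  simp [oddEntry]

theorem evenEntry_eq_sum (n : ℕ) {ρ : ℝ} (hρ : 0 < ρ) (hρ1 : ρ < 1) (a i : ℕ) :
    evenEntry n a i =
      ∑ l ∈ range (i + 1), (-1 : ℂ) ^ i * (i.choose l : ℂ) * h0 n ρ (a + l) := by
  rw [evenEntry, add_pow, sum_mul, map_sum, mul_sum]
  refine sum_congr rfl fun l hl => ?_
  rw [mem_range] at hl
  rw [h0_eq_coeff n hρ hρ1, one_pow, one_mul, mul_comm (X ^ (i - l)), mul_assoc,
    ← map_natCast (C (R := ℂ)), coeff_C_mul, coeff_X_pow_mul', if_pos (by omega),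
    show a + i - (i - l) = a + l by omega, mul_assoc]

theorem oddEntry_eq_sum (n : ℕ) {ρ : ℝ} (hρ : 0 < ρ) (a i : ℕ) :
    oddEntry n a i =
      ∑ l ∈ range (a + 1), (-1 : ℂ) ^ (i + l) *
        ((Ring.choose ((i : ℤ) - 1 + (l : ℤ)) l : ℤ) : ℂ) * h1 n ρ (a - l) := by
  rw [oddEntry, mul_comm (hSeries n), coeff_mul, mul_sum,
    Nat.sum_antidiagonal_eq_sum_range_succ (fun l m => (-1 : ℂ) ^ i *
      (coeff l (binomialSeries ℂ (-(i : ℤ))) * coeff m (hSeries n)))]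
  refine sum_congr rfl fun l _ => ?_
  rw [h1_eq_coeff n hρ, binomialSeries_coeff, Ring.choose_neg,
    show (i : ℤ) + l - 1 = (i : ℤ) - 1 + l by ring, pow_add, zsmul_one, Units.smul_def,
    smul_eq_mul, Int.cast_mul, Int.cast_negOnePow_natCast]
  ring

theorem evenEntry_rec (n a i : ℕ) :
    evenEntry n (a + 1) i + evenEntry n a (i + 1) + evenEntry n a i = 0 := by
  rw [evenEntry, evenEntry, evenEntry, pow_succ' (1 + X : ℂ⟦X⟧), mul_assoc, ← add_assoc a i 1,
    coeff_one_add_X_mul, add_right_comm a 1 i, pow_succ]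
  ring

/-- `H (1 + X)^{-i} = (1 + X) H (1 + X)^{-(i+1)}`. -/
theorem hSeries_mul_binomialSeries (n i : ℕ) :
    hSeries n * binomialSeries ℂ (-(i : ℤ)) =
      (1 + X) * (hSeries n * binomialSeries ℂ (-((i + 1 : ℕ) : ℤ))) := by
  have h : binomialSeries ℂ (-(i : ℤ)) =
      binomialSeries ℂ (-((i + 1 : ℕ) : ℤ)) * (1 + X) ^ 1 := by
    rw [← binomialSeries_nat (R := ℤ), ← binomialSeries_add]
    congr 1
    push_cast
    ring
  rw [h]
  ring

theorem oddEntry_rec (n a i : ℕ) :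
    oddEntry n a (i + 1) + oddEntry n (a + 1) (i + 1) + oddEntry n (a + 1) i = 0 := by
  rw [oddEntry, oddEntry, oddEntry, hSeries_mul_binomialSeries n i, coeff_one_add_X_mul, pow_succ]
  ring

theorem oddEntry_rec_zero (n i : ℕ) : oddEntry n 0 (i + 1) + oddEntry n 0 i = 0 := by
  rw [oddEntry, oddEntry, hSeries_mul_binomialSeries n i, add_mul, one_mul, map_add,
    coeff_zero_X_mul, pow_succ]
  ring

/-- The `k`-th term of `H (1 + X)^{-(n-j)}` is `X^{2k} (1 + X)^{j-k}` for `k ≤ j`, of degree less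
than `2j + 1`; for `k > j` it is divisible by `X^{2j+2}`. -/
theorem oddEntry_top {n j : ℕ} (hj : j < n) : oddEntry n (2 * j + 1) (n - j) = 0 := by
  rw [oddEntry, coeff_hSeries_mul, sum_eq_zero, mul_zero]
  intro k hk
  rw [mem_range] at hk
  split_ifs with h
  · have e : (1 + X : ℂ⟦X⟧) ^ (n - k) * binomialSeries ℂ (-((n - j : ℕ) : ℤ)) =
        (1 + X) ^ (j - k) := by
      rw [← binomialSeries_nat (R := ℤ), ← binomialSeries_nat (R := ℤ), ← binomialSeries_add]
      congr 1
      omega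
    rw [e, coeff_one_add_X_pow, Nat.choose_eq_zero_of_lt (by omega), Nat.cast_zero, mul_zero]
  · rw [mul_zero]

theorem one_add_X_mul_h0Series (n : ℕ) :
    (1 + X) * h0Series n = X * ((1 + X) * (hSeries n * geom)) - geom := by
  have h : (1 + X : ℂ⟦X⟧) * (PowerSeries.mk fun i => (((i + 1) % 2 : ℕ) : ℂ)) = geom := by
    ext i
    rcases i with _ | i
    · simp [geom, add_mul]
    · rw [coeff_one_add_X_mul, coeff_mk, coeff_mk, ← Nat.cast_add,
        show (i + 1 + 1) % 2 + (i + 1) % 2 = 1 by omega]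
      simp [geom]
  rw [h0Series]
  linear_combination -h

theorem evenEntry_top {n j : ℕ} (hj : j < n) : evenEntry n (2 * j) (n + 1 - j) = 0 := by
  obtain ⟨t, rfl⟩ := Nat.exists_eq_add_of_le hj.le
  rw [evenEntry, show j + t + 1 - j = t + 1 by omega]
  have h : (1 + X) ^ (t + 1) * h0Series (j + t) =
      X * ((1 + X) ^ (t + 1) * (hSeries (j + t) * geom)) - (1 + X) ^ t * geom := by
    rw [pow_succ]
    linear_combination (1 + X) ^ t * one_add_X_mul_h0Series (j + t)
  have h2 := coeff_one_add_X_pow_mul_hSeries_mul_geom (n := j + t) (t := t) (by omega)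
  rw [show 2 * (j + t) - t = 2 * j + t by omega] at h2
  rw [h, map_sub, ← add_assoc, coeff_succ_X_mul, h2, coeff_one_add_X_pow_mul_geom (by omega),
    sub_self, mul_zero]

theorem h0Series_eq (n : ℕ) : h0Series n = X * (X * h0Series n) + X * ((1 + X) * hSeries n) - 1 := by
  linear_combination (1 - X) * one_add_X_mul_h0Series n +
    (X * (1 + X) * hSeries n - 1) * geom_mul_one_sub

theorem diag_rec (n a : ℕ) :
    oddEntry n a 0 + evenEntry n a 0 + oddEntry n (a + 1) 0 - evenEntry n (a + 2) 0 = 0 := by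
  have h := congrArg (coeff (a + 2)) (h0Series_eq n)
  rw [map_sub, map_add, coeff_succ_X_mul, coeff_succ_X_mul, coeff_succ_X_mul,
    coeff_one_add_X_mul, coeff_one, if_neg (by omega)] at h
  rw [oddEntry_zero, oddEntry_zero, evenEntry_zero, evenEntry_zero, h]
  ring

theorem diag_rec_zero (n : ℕ) : oddEntry n 0 0 - evenEntry n 1 0 = 0 := by
  have h := congrArg (coeff 1) (h0Series_eq n)
  rw [map_sub, map_add, coeff_succ_X_mul, coeff_zero_X_mul, coeff_succ_X_mul,
    add_mul, map_add, one_mul, coeff_zero_X_mul, coeff_one, if_neg (by omega)] at h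
  rw [oddEntry_zero, evenEntry_zero, h]
  ring

theorem X_mul_hSeries_mul_geom (n : ℕ) :
    X * (hSeries n * geom) = hSeries n * geom - hSeries n := by
  linear_combination (-hSeries n) * geom_mul_one_sub

theorem coeff_X_mul_hSeries_mul_geom (n : ℕ) :
    coeff (2 * n) (X * (hSeries n * geom)) = if n % 2 = 0 then 0 else 1 := by
  rw [X_mul_hSeries_mul_geom, map_sub, coeff_hSeries_mul_geom, coeff_hSeries_last]
  split_ifs with h
  · rw [(Nat.even_iff.2 h).neg_one_pow, sub_self]
  · rw [(Nat.odd_iff.2 (by omega)).neg_one_pow]; norm_num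

theorem evenEntry_last (n : ℕ) : evenEntry n (2 * n) 0 = if n % 2 = 0 then -1 else 0 := by
  rw [evenEntry_zero, h0Series, map_sub, coeff_X_mul_hSeries_mul_geom, coeff_mk,
    show (2 * n + 1) % 2 = 1 by omega]
  split_ifs <;> norm_num

theorem oddEntry_add_evenEntry_last (n m : ℕ) (hm : n = m + 1) :
    oddEntry n (2 * m + 1) 0 + evenEntry n (2 * m + 1) 0 = if n % 2 = 0 then 0 else 1 := by
  rw [oddEntry_zero, evenEntry_zero, ← coeff_X_mul_hSeries_mul_geom, h0Series,
    X_mul_hSeries_mul_geom, map_sub, map_sub, coeff_mk, show (2 * m + 1 + 1) % 2 = 0 by omega,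
    ← X_mul_hSeries_mul_geom, show 2 * n = 2 * m + 1 + 1 by omega, coeff_succ_X_mul]
  simp

/-- The column of `K n` inverse indexed by the corner vertex, as a function on `ℕ × ℕ`. -/
noncomputable def column (n : ℕ) : ℕ × ℕ → ℂ := colEntry n (evenEntry n) (oddEntry n)

open Matrix in
theorem mulVec_column (n : ℕ) :
    (K n *ᵥ fun y => column n y.1) = Pi.single (bVertex n) 1 :=
  mulVec_colEntry (evenEntry_rec n) (oddEntry_rec n) (oddEntry_rec_zero n)
    (fun _ => evenEntry_top) (fun _ => oddEntry_top) (diag_rec n) (diag_rec_zero n)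
    (evenEntry_last n) (oddEntry_add_evenEntry_last n)

theorem isUnit_det_K (n : ℕ) : IsUnit (K n).det :=
  isUnit_iff_ne_zero.2 (det_K_ne_zero (fun n => ⟨_, mulVec_column n⟩) n)

theorem inv_K_apply_bVertex (n : ℕ) (x : V n) : (K n)⁻¹ x (bVertex n) = column n x.1 := by
  have h := congrArg (Matrix.mulVec (K n)⁻¹) (mulVec_column n)
  rw [Matrix.mulVec_mulVec, Matrix.nonsing_inv_mul _ (isUnit_det_K n), Matrix.one_mulVec,
    Matrix.mulVec_single_one] at h
  exact (congrFun h x).symm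

end TSSCPP

/-- `K_n` is invertible, and the column of `K_n⁻¹` indexed by the corner vertex is given by the
contour integral formulas, for every circle of radius `ρ ∈ (0,1)` as the contour. The binomial
`Ring.choose a l` with `a : ℤ` is `a (a-1) ⋯ (a-l+1) / l!`, and `(i₁ + 1) / 2`, `i₁ / 2` are the
ceiling and the floor of half of `i₁`. -/
theorem theorem3p1 (n : ℕ) (ρ : ℝ) (hρ0 : 0 < ρ) (hρ1 : ρ < 1) :
    IsUnit (TSSCPP.K n).det ∧
    (∀ i₁ i₂ : ℕ, i₁ < 2 * n → i₂ + (i₁ + 1) / 2 ≤ n →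
      ∃ hx : (i₁, i₁ + 2 * i₂ + 1) ∈ TSSCPP.V n,
        (TSSCPP.K n)⁻¹ ⟨(i₁, i₁ + 2 * i₂ + 1), hx⟩ (TSSCPP.bVertex n) =
          ∑ l ∈ Finset.range (i₁ + 1),
            (-1 : ℂ) ^ (i₂ + l) * ((Ring.choose ((i₂ : ℤ) - 1 + (l : ℤ)) l : ℤ) : ℂ) *
              TSSCPP.h1 n ρ (i₁ - l)) ∧
    (∀ i₁ i₂ : ℕ, i₁ ≤ 2 * n → i₂ + i₁ / 2 ≤ n →
      ∃ hx : (i₁, i₁ + 2 * i₂) ∈ TSSCPP.V n,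
        (TSSCPP.K n)⁻¹ ⟨(i₁, i₁ + 2 * i₂), hx⟩ (TSSCPP.bVertex n) =
          ∑ l ∈ Finset.range (i₂ + 1),
            (-1 : ℂ) ^ i₂ * (Nat.choose i₂ l : ℂ) * TSSCPP.h0 n ρ (i₁ + l)) ∧
    (TSSCPP.K n)⁻¹ (TSSCPP.bVertex n) (TSSCPP.bVertex n) = 0 ∧
    (Even n → ∃ hx : (2 * n, 2 * n) ∈ TSSCPP.V n,
      (TSSCPP.K n)⁻¹ ⟨(2 * n, 2 * n), hx⟩ (TSSCPP.bVertex n) = -1) := by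
  refine ⟨TSSCPP.isUnit_det_K n, fun i₁ i₂ h₁ h₂ => ?_, fun i₁ i₂ h₁ h₂ => ?_, ?_, fun hn => ?_⟩
  · have hx : (i₁, i₁ + 2 * i₂ + 1) ∈ TSSCPP.V n := TSSCPP.mem_V.2 (by omega)
    exact ⟨hx, by rw [TSSCPP.inv_K_apply_bVertex, TSSCPP.column,
      TSSCPP.colEntry_odd hx rfl h₁.ne, TSSCPP.oddEntry_eq_sum n hρ0]⟩
  · have hx : (i₁, i₁ + 2 * i₂) ∈ TSSCPP.V n := TSSCPP.mem_V.2 (by omega)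
    exact ⟨hx, by rw [TSSCPP.inv_K_apply_bVertex, TSSCPP.column,
      TSSCPP.colEntry_even hx rfl, TSSCPP.evenEntry_eq_sum n hρ0 hρ1]⟩
  · rw [TSSCPP.inv_K_apply_bVertex, TSSCPP.column]
    have hb := (TSSCPP.bVertex n).2
    rcases Nat.mod_two_eq_zero_or_one n with h | h
    · exact TSSCPP.colEntry_odd_last rfl (by omega)
    · rw [TSSCPP.bVertex] at hb ⊢
      rw [TSSCPP.colEntry_even (i := 0) hb (by omega), TSSCPP.evenEntry_last, if_neg (by omega)]
  · have hx : (2 * n, 2 * n) ∈ TSSCPP.V n := TSSCPP.mem_V.2 (by omega)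
    exact ⟨hx, by rw [TSSCPP.inv_K_apply_bVertex, TSSCPP.column,
      TSSCPP.colEntry_even (i := 0) hx rfl, TSSCPP.evenEntry_last,
      if_pos (Nat.even_iff.1 hn)]⟩
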